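/- All graphs are finite and simple. For a word $w$ over an alphabet $V$ and distinct $x,y\in V$, let $w|_{\{x,y\}}$ be the word obtained from $w$ by deleting all letters other than $x$ and $y$. A graph $G=(V,E)$ is *word-representable* if there is a word $w$ over $V$ such that, for all distinct $x,y\in V$, $xy\in E$ if and only if $x$ and $y$ alternate in $w$ (no two consecutive letters of $w|_{\{x,y\}}$ are equal). It is *$1$-$11$-representable* if there is a word $w$ over $V$ such that, for all distinct $x,y\in V$, $xy\in E$ if and only if $w|_{\{x,y\}}$ contains in total at most one occurrence of the factors $xx$ and $yy$. A *comparability graph* is a graph that admits a transitive orientation, and a *circle graph* is the intersection graph of a family of chords of a circle. The *Chvátal graph* is the graph with vertex set $\{1,\dots,12\}$ and the $24$ edges $\{1,2\},\{1,4\},\{1,7\},\{1,12\},\{2,3\},\{2,6\},\{2,9\},\{3,4\},\{3,8\},\{3,11\},\{4,5\},\{4,10\},\{5,6\},\{5,9\},\{5,12\},\{6,7\},\{6,10\},\{7,8\},\{7,11\},\{8,9\},\{8,12\},\{9,10\},\{10,11\},\{11,12\}$. Consider the following three known tools for establishing $1$-$11$-representability. 1. (a) If $G_1$ and $G_2$ are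 $1$-$11$-representable, then so are their disjoint union, any graph obtained by glueing them in a vertex (identifying a vertex of $G_1$ with a vertex of $G_2$), and any graph obtained by connecting them by an edge (adding to the disjoint union one edge between a vertex of $G_1$ and a vertex of $G_2$). (b) If $G$ is $1$-$11$-representable and $xy$ is an edge of $G$, then adding to $G$ a new vertex adjacent to $x$ and $y$ only gives a $1$-$11$-representable graph. 2. If $G$ is word-representable, $A\subseteq V(G)$ and $v\in V(G)$, then (a) $G\setminus\{xy\in E(G) : x,y\in A\}$ and (b) $G\setminus\{uv\in E(G) : u\in A\}$ are $1$-$11$-representable. 3. If $G$ has a vertex $v$ such that $G\setminus v$ is (a) a comparability graph or (b) a circle graph, then $G$ is $1$-$11$-representable. Then the $1$-$11$-representability of the Chvátal graph does not follow from these tools. Precisely: * The Chvátal graph does not belong to the smallest isomorphism-closed class of graphs that contains all word-representable graphs, all graphs produced from word-representable graphs by Tool 2 and all graphs satisfying the hypothesis of Tool 3, and that is closed under the operations of Tool 1. * No single tool applies to the Chvátal graph. It is not (isomorphic to) the disjoint union of two $1$-$11$-representable graphs with fewer than $12$ vertices each, nor is it obtained from two such graphs by glueing them in a vertex or by connecting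 them by an edge. It is not obtained from a $1$-$11$-representable graph by adding a vertex as in Tool 1(b). It is not of the form $G\setminus\{xy\in E(G) : x,y\in A\}$ or $G\setminus\{uv\in E(G) : u\in A\}$ with $G$ word-representable, $A\subseteq V(G)$ and $v\in V(G)$. And for no vertex $v$ is the Chvátal graph minus $v$ a comparability graph or a circle graph. -/

import Mathlib

namespace ElevenRep

open SimpleGraph

/-! ### Words and representability -/

open Classical in
/-- `w|_{x,y}`: the subword of `w` induced by the letters `x` and `y`. -/
noncomputable def restrict {V : Type*} (w : List V) (x y : V) : List V :=
  w.filter (fun z => z = x ∨ z = y)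

/-- The letters `x` and `y` alternate in `w`: no two consecutive letters of `w|_{x,y}` are equal. -/
def Alternate {V : Type*} (w : List V) (x y : V) : Prop :=
  (restrict w x y).IsChain (· ≠ ·)

/-- `G` is word-representable. -/
def WordRepresentable {V : Type*} (G : SimpleGraph V) : Prop :=
  ∃ w : List V, ∀ x y : V, x ≠ y → (Alternate w x y ↔ G.Adj x y)

open Classical in
/-- The number of occurrences in `u` of the consecutive pattern `11`, i.e. of positions at which a
letter is immediately followed by the same letter. -/
noncomputable def count11 {V : Type*} (u : List V) : ℕ :=
  (u.zip u.tail).countP (fun p => p.1 = p.2)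

/-- `G` is `k`-`11`-representable. -/
def ElevenRepresentable {V : Type*} (k : ℕ) (G : SimpleGraph V) : Prop :=
  ∃ w : List V, ∀ x y : V, x ≠ y → (count11 (restrict w x y) ≤ k ↔ G.Adj x y)

/-! ### Comparability graphs and circle graphs -/

/-- `r` is an orientation of `G`: every edge receives exactly one of its two directions. -/
def IsOrientation {V : Type*} (G : SimpleGraph V) (r : V → V → Prop) : Prop :=
  (∀ u v, G.Adj u v ↔ r u v ∨ r v u) ∧ ∀ u v, r u v → ¬ r v u

/-- `G` admits a transitive orientation. -/
def IsComparabilityGraph {V : Type*} (G : SimpleGraph V) : Prop :=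
  ∃ r : V → V → Prop, IsOrientation G r ∧ ∀ u v z, r u v → r v z → r u z

/-- `G` is the intersection graph of a family of chords of a circle. The circle is the unit circle
of the complex plane, and the chord of `v` is the segment joining the points `p v ≠ q v`. -/
def IsCircleGraph {V : Type*} (G : SimpleGraph V) : Prop :=
  ∃ p q : V → ℂ, (∀ v, ‖p v‖ = 1 ∧ ‖q v‖ = 1 ∧ p v ≠ q v) ∧
    ∀ u v, u ≠ v →
      (G.Adj u v ↔ (segment ℝ (p u) (q u) ∩ segment ℝ (p v) (q v)).Nonempty)

/-! ### Graph operations -/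

/-- The graph `G \ v`. -/
abbrev deleteVertex {V : Type*} (G : SimpleGraph V) (v : V) : SimpleGraph {u : V // u ≠ v} :=
  G.comap Subtype.val

/-- The disjoint union of `G₁` and `G₂` together with one new edge joining `a` to `b`. -/
def connectByEdge {V₁ V₂ : Type*} (G₁ : SimpleGraph V₁) (G₂ : SimpleGraph V₂) (a : V₁) (b : V₂) :
    SimpleGraph (V₁ ⊕ V₂) :=
  (G₁ ⊕g G₂) ⊔ edge (Sum.inl a) (Sum.inr b)

/-- The graph obtained from `G₁` and `G₂` by identifying the vertex `a` of `G₁` with the vertex `b`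
of `G₂`; the common vertex is represented by `Sum.inl a`. -/
def glue {V₁ V₂ : Type*} (G₁ : SimpleGraph V₁) (G₂ : SimpleGraph V₂) (a : V₁) (b : V₂) :
    SimpleGraph (V₁ ⊕ {y : V₂ // y ≠ b}) where
  Adj
    | Sum.inl x, Sum.inl y => G₁.Adj x y
    | Sum.inr x, Sum.inr y => G₂.Adj x y
    | Sum.inl x, Sum.inr y => x = a ∧ G₂.Adj b y
    | Sum.inr x, Sum.inl y => y = a ∧ G₂.Adj b x
  symm := ⟨by
    rintro (x | x) (y | y) h
    · exact G₁.adj_symm h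
    · exact h
    · exact h
    · exact G₂.adj_symm h⟩
  loopless := ⟨by
    rintro (x | x) h
    · exact G₁.loopless.irrefl _ h
    · exact G₂.loopless.irrefl _ h⟩

/-- The graph obtained from `G` by adding a new vertex `none` adjacent to `x` and `y` only. -/
def addVertex {V : Type*} (G : SimpleGraph V) (x y : V) : SimpleGraph (Option V) where
  Adj
    | some u, some v => G.Adj u v
    | none, some v => v = x ∨ v = y
    | some u, none => u = x ∨ u = y
    | none, none => False
  symm := ⟨by
    rintro (_ | x) (_ | y) h
    · exact h
    · exact h
    · exact h
    · exact G.adj_symm h⟩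
  loopless := ⟨by
    rintro (_ | x) h
    · exact h
    · exact G.loopless.irrefl _ h⟩

/-- `G \ {xy ∈ E(G) | x, y ∈ A}`. -/
def removeInside {V : Type*} (G : SimpleGraph V) (A : Set V) : SimpleGraph V :=
  G.deleteEdges {e | ∃ x ∈ A, ∃ y ∈ A, e = s(x, y)}

/-- `G \ {uv ∈ E(G) | u ∈ N_A(v)}`. -/
def removeStar {V : Type*} (G : SimpleGraph V) (A : Set V) (v : V) : SimpleGraph V :=
  G.deleteEdges {e | ∃ u ∈ A ∩ G.neighborSet v, e = s(u, v)}

/-! ### Derivability by the tools -/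

/-- The finite graphs whose `1`-`11`-representability can be derived by the tools, used any number
of times and in any combination, starting from the word-representable graphs. -/
inductive Derivable : ∀ {V : Type}, SimpleGraph V → Prop
  | wordRepresentable {V : Type} [Finite V] {G : SimpleGraph V} :
      WordRepresentable G → Derivable G
  | iso {V W : Type} {G : SimpleGraph V} {H : SimpleGraph W} :
      Derivable G → Nonempty (G ≃g H) → Derivable H
  | disjointUnion {V₁ V₂ : Type} {G₁ : SimpleGraph V₁} {G₂ : SimpleGraph V₂} :
      Derivable G₁ → Derivable G₂ → Derivable (G₁ ⊕g G₂)
  | glue {V₁ V₂ : Type} {G₁ : SimpleGraph V₁} {G₂ : SimpleGraph V₂} (a : V₁) (b : V₂) :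
      Derivable G₁ → Derivable G₂ → Derivable (glue G₁ G₂ a b)
  | connectByEdge {V₁ V₂ : Type} {G₁ : SimpleGraph V₁} {G₂ : SimpleGraph V₂} (a : V₁) (b : V₂) :
      Derivable G₁ → Derivable G₂ → Derivable (connectByEdge G₁ G₂ a b)
  | addVertex {V : Type} {G : SimpleGraph V} (x y : V) :
      G.Adj x y → Derivable G → Derivable (addVertex G x y)
  | removeInside {V : Type} [Finite V] {G : SimpleGraph V} (A : Set V) :
      WordRepresentable G → Derivable (removeInside G A)
  | removeStar {V : Type} [Finite V] {G : SimpleGraph V} (A : Set V) (v : V) :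
      WordRepresentable G → Derivable (removeStar G A v)
  | comparability {V : Type} [Finite V] {G : SimpleGraph V} (v : V) :
      IsComparabilityGraph (deleteVertex G v) → Derivable G
  | circle {V : Type} [Finite V] {G : SimpleGraph V} (v : V) :
      IsCircleGraph (deleteVertex G v) → Derivable G

/-! ### The Chvátal graph -/

/-- The 24 edges of the Chvátal graph, on the vertices `1, …, 12`. -/
def chvatalEdges : List (ℕ × ℕ) :=
  [(5, 6), (5, 12), (5, 9), (7, 6), (7, 8), (7, 11), (9, 8), (9, 10), (11, 10), (11, 12),
   (8, 12), (6, 10), (1, 2), (1, 4), (1, 12), (1, 7), (3, 2), (3, 4), (3, 11), (3, 8),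
   (2, 6), (2, 9), (4, 5), (4, 10)]

/-- The Chvátal graph; the element `i` of `Fin 12` is the vertex labelled `i + 1`. -/
def chvatal : SimpleGraph (Fin 12) where
  Adj i j := (i.val + 1, j.val + 1) ∈ chvatalEdges ∨ (j.val + 1, i.val + 1) ∈ chvatalEdges
  symm := ⟨fun _ _ h => h.symm⟩
  loopless := ⟨by decide⟩

end ElevenRep

/-! The invariant is the absence of an induced Chvátal graph: every starting graph has it and every
operation of Tool 1 preserves it (`Derivable.isEmpty_embedding`).

A word orients each edge by which of two alternating letters comes first. If three consecutive edges
of a four-cycle agree in direction around it, counting letters in prefixes forces both diagonals to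
be edges (`adj_of_leads`). So a four-cycle missing a diagonal has two edges in each direction, and
the signs of its edges, read around it, add to zero (`sign_fourCycle`). In the Chvátal graph a
signed sum of eleven four-cycles is twice a five-cycle; the signs around the five-cycle would then
add to zero, but they are five odd numbers (`not_wordRepresentable_of_chvatal`).

That argument needs only a supergraph in which no four-cycle of the Chvátal graph acquires both
diagonals. Hence, if Tool 2 produced a Chvátal graph, it would delete both diagonals of one of its
four-cycles while keeping the four sides, which neither form of deletion can do.

Tool 1 is excluded by two-connectedness and minimum degree at least three. For Tool 3, each
vertex-deleted Chvátal graph keeps a five-cycle, impossible in a triangle-free comparability graph,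
and an induced subgraph that no circle graph contains (`IsCircleGraph.false_of_cube_minus_vertex`).
-/

namespace ElevenRep

open SimpleGraph

/-! ### Alternation of letters in a word -/

open Classical in
/-- In every prefix of `w` the letter `x` occurs as often as `y`, or once more: `x` and `y`
alternate in `w`, and `y` does not come first. -/
def Leads {V : Type*} (w : List V) (x y : V) : Prop :=
  ∀ u, u <+: w → u.count y ≤ u.count x ∧ u.count x ≤ u.count y + 1

theorem restrict_comm {V : Type*} (w : List V) (x y : V) : restrict w x y = restrict w y x := by
  exact List.filter_congr fun z _ => decide_eq_decide.2 or_comm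

/-- The prepended `x` records the last letter read, which closes the induction on `w`: reading `y`
swaps the two roles, reading `x` breaks both sides, and any other letter changes nothing. -/
theorem isChain_cons_restrict_iff {V : Type*} (w : List V) {x y : V} (hxy : x ≠ y) :
    (x :: restrict w x y).IsChain (· ≠ ·) ↔ Leads w y x := by
  classical
  induction w generalizing x y with
  | nil => simp [restrict, Leads]
  | cons z w ih =>
    by_cases hx : z = x
    · subst hx
      have h1 : ¬ Leads (z :: w) y z := fun h => by
        have := (h [z] (by simp)).1
        simp [hxy] at this
      simp [restrict, h1]
    · by_cases hy : z = y
      · subst hy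
        have h1 : restrict (z :: w) x z = z :: restrict w z x := by
          rw [restrict_comm w z x]; simp [restrict]
        rw [h1, List.isChain_cons_cons, ih hxy.symm]
        simp only [Leads, List.prefix_cons_iff]
        constructor
        · rintro ⟨-, h⟩ u (rfl | ⟨t, rfl, ht⟩)
          · simp
          · have := h t ht
            simp only [List.count_cons_self, List.count_cons_of_ne hx]
            omega
        · intro h
          refine ⟨hxy, fun t ht => ?_⟩
          have := h (z :: t) (Or.inr ⟨t, rfl, ht⟩)
          simp only [List.count_cons_self, List.count_cons_of_ne hx] at this
          omega
      · have h1 : restrict (z :: w) x y = restrict w x y := by simp [restrict, hx, hy]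
        rw [h1, ih hxy]
        simp only [Leads, List.prefix_cons_iff]
        constructor
        · rintro h u (rfl | ⟨t, rfl, ht⟩)
          · simp
          · simpa [List.count_cons_of_ne hx, List.count_cons_of_ne hy] using h t ht
        · intro h t ht
          simpa [List.count_cons_of_ne hx, List.count_cons_of_ne hy] using
            h (z :: t) (Or.inr ⟨t, rfl, ht⟩)

/-- Prepending the letter that does not come first in the restriction creates no repetition, so
alternation means that one of the two prepended words alternates. -/
theorem alternate_iff_leads {V : Type*} (w : List V) {x y : V} (hxy : x ≠ y) :
    Alternate w x y ↔ Leads w x y ∨ Leads w y x := by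
  rw [← isChain_cons_restrict_iff w hxy, ← isChain_cons_restrict_iff w hxy.symm,
    restrict_comm w y x, Alternate]
  have hmem : ∀ z ∈ restrict w x y, z = x ∨ z = y := by
    intro z hz
    simpa [restrict] using (List.mem_filter.1 hz).2
  cases h : restrict w x y with
  | nil => simp
  | cons z l =>
    rw [h] at hmem
    simp only [List.isChain_cons_cons]
    rcases hmem z (by simp) with rfl | rfl
    · simp [hxy.symm]
    · simp [hxy]

/-- A word-representant induces no shortcut on four vertices. -/
theorem adj_of_leads {V : Type*} {G : SimpleGraph V} {w : List V}
    (hw : ∀ x y : V, x ≠ y → (Alternate w x y ↔ G.Adj x y)) {a b c d : V}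
    (hac : a ≠ c) (hbd : b ≠ d) (hab : Leads w a b) (hbc : Leads w b c) (hcd : Leads w c d)
    (had : G.Adj a d) : G.Adj a c ∧ G.Adj b d := by
  have hne := had.ne
  rw [← hw _ _ hne, alternate_iff_leads _ hne] at had
  rw [← hw _ _ hac, ← hw _ _ hbd, alternate_iff_leads _ hac, alternate_iff_leads _ hbd]
  -- In each prefix the counts do not increase along `a, b, c, d`. Alternation of `a` and `d` bounds
  -- the total drop by one, hence also the drops from `a` to `c` and from `b` to `d`.
  refine ⟨Or.inl fun u hu => ?_, Or.inl fun u hu => ?_⟩ <;>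
  · have h1 := hab u hu
    have h2 := hbc u hu
    have h3 := hcd u hu
    rcases had with h | h <;>
    · have h4 := h u hu
      omega

open Classical in
/-- The direction which the word `w` gives to an edge `xy`, as a sign; the comparison of the
vertices makes the sign antisymmetric. -/
noncomputable def sign {ι V : Type*} [LinearOrder ι] (w : List V) (f : ι → V) (i j : ι) : ℤ :=
  if i < j then (if Leads w (f i) (f j) then 1 else -1)
  else (if Leads w (f j) (f i) then -1 else 1)

/-- For distinct letters both directions hold only when neither letter occurs in `w`. Comparing the
indices breaks this tie consistently. -/
theorem sign_swap {ι V : Type*} [LinearOrder ι] (w : List V) (f : ι → V) {i j : ι} (h : i ≠ j) :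
    sign w f j i = - sign w f i j := by
  unfold sign
  rcases lt_or_gt_of_ne h with h | h
  · simp only [h, not_lt_of_gt h, if_true, if_false]
    split_ifs <;> simp
  · simp only [h, not_lt_of_gt h, if_true, if_false]
    split_ifs <;> simp

theorem sign_spec {ι V : Type*} [LinearOrder ι] (w : List V) (f : ι → V) {i j : ι}
    (h : Leads w (f i) (f j) ∨ Leads w (f j) (f i)) :
    (sign w f i j = 1 ∧ Leads w (f i) (f j)) ∨ (sign w f i j = -1 ∧ Leads w (f j) (f i)) := by
  unfold sign
  split_ifs <;> simp_all

/-- A four-cycle which is not a clique has two edges in each direction. -/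
theorem sign_fourCycle {ι V : Type*} [LinearOrder ι] {G : SimpleGraph V} {w : List V}
    (hw : ∀ x y : V, x ≠ y → (Alternate w x y ↔ G.Adj x y)) {f : ι → V} {a b c d : ι}
    (hac : f a ≠ f c) (hbd : f b ≠ f d) (hab : G.Adj (f a) (f b)) (hbc : G.Adj (f b) (f c))
    (hcd : G.Adj (f c) (f d)) (hda : G.Adj (f d) (f a))
    (hn : ¬ (G.Adj (f a) (f c) ∧ G.Adj (f b) (f d))) :
    sign w f a b + sign w f b c + sign w f c d + sign w f d a = 0 := by
  have key : ∀ {i j : ι}, G.Adj (f i) (f j) →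
      (sign w f i j = 1 ∧ Leads w (f i) (f j)) ∨ (sign w f i j = -1 ∧ Leads w (f j) (f i)) :=
    fun h => sign_spec w f ((alternate_iff_leads w h.ne).1 ((hw _ _ h.ne).2 h))
  have hca := hac.symm
  have hdb := hbd.symm
  have hn' : ∀ {p q r s : V}, G.Adj p s → p ≠ r → q ≠ s → Leads w p q → Leads w q r →
      Leads w r s → ¬ (G.Adj p r ∧ G.Adj q s) → False :=
    fun h1 h2 h3 h4 h5 h6 h7 => h7 (adj_of_leads hw h2 h3 h4 h5 h6 h1)
  -- With `hn`, these cover the four starting points and two directions in which a path of three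
  -- edges can run around the cycle.
  have n1 : ¬ (G.Adj (f b) (f d) ∧ G.Adj (f c) (f a)) := fun h => hn ⟨h.2.symm, h.1⟩
  have n2 : ¬ (G.Adj (f c) (f a) ∧ G.Adj (f d) (f b)) := fun h => hn ⟨h.1.symm, h.2.symm⟩
  have n3 : ¬ (G.Adj (f d) (f b) ∧ G.Adj (f a) (f c)) := fun h => hn ⟨h.2, h.1.symm⟩
  have n4 : ¬ (G.Adj (f c) (f a) ∧ G.Adj (f b) (f d)) := fun h => hn ⟨h.1.symm, h.2⟩
  have n5 : ¬ (G.Adj (f b) (f d) ∧ G.Adj (f a) (f c)) := fun h => hn ⟨h.2, h.1⟩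
  have n6 : ¬ (G.Adj (f a) (f c) ∧ G.Adj (f d) (f b)) := fun h => hn ⟨h.1, h.2.symm⟩
  have n7 : ¬ (G.Adj (f d) (f b) ∧ G.Adj (f c) (f a)) := fun h => hn ⟨h.2.symm, h.1.symm⟩
  clear hw
  generalize Leads w = R at key hn'
  -- Of the sixteen sign patterns the balanced ones sum to zero. Every other one contains three
  -- consecutive edges in the same direction, which `hn'` excludes.
  rcases key hab with ⟨e1, l1⟩ | ⟨e1, l1⟩ <;> rcases key hbc with ⟨e2, l2⟩ | ⟨e2, l2⟩ <;>
    rcases key hcd with ⟨e3, l3⟩ | ⟨e3, l3⟩ <;> rcases key hda with ⟨e4, l4⟩ | ⟨e4, l4⟩ <;>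
    rw [e1, e2, e3, e4] <;> first
    | norm_num; done
    | exact (hn' hda.symm hac hbd l1 l2 l3 hn).elim
    | exact (hn' hab.symm hbd hca l2 l3 l4 n1).elim
    | exact (hn' hbc.symm hca hdb l3 l4 l1 n2).elim
    | exact (hn' hcd.symm hdb hac l4 l1 l2 n3).elim
    | exact (hn' hda hdb hca l3 l2 l1 n7).elim
    | exact (hn' hab hac hdb l4 l3 l2 n6).elim
    | exact (hn' hbc hbd hac l1 l4 l3 n5).elim
    | exact (hn' hcd hca hbd l2 l1 l4 n4).elim

/-! ### Properties of the Chvátal graph -/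

instance : DecidableRel chvatal.Adj := fun i j =>
  inferInstanceAs (Decidable ((i.val + 1, j.val + 1) ∈ chvatalEdges ∨
    (j.val + 1, i.val + 1) ∈ chvatalEdges))

theorem chvatal_triangleFree :
    ∀ a b c, chvatal.Adj a b → chvatal.Adj b c → ¬ chvatal.Adj a c := by
  decide

/-- This keeps a copy of the Chvátal graph from using the new vertex of `addVertex`, or from having
a vertex attached to the rest only by the new edge of `connectByEdge`. -/
theorem chvatal_exists_three_neighbors (u : Fin 12) : ∃ x y z, x ≠ y ∧ x ≠ z ∧ y ≠ z ∧
    chvatal.Adj u x ∧ chvatal.Adj u y ∧ chvatal.Adj u z := by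
  revert u
  decide

/-- Deleting a vertex leaves the Chvátal graph connected. -/
theorem chvatal_monochromatic_of_ne (u : Fin 12) (c : Fin 12 → Prop)
    (h : ∀ i j, i ≠ u → j ≠ u → chvatal.Adj i j → (c i ↔ c j)) :
    (∀ i, i ≠ u → c i) ∨ ∀ i, i ≠ u → ¬ c i := by
  have e : ∀ i j, chvatal.Adj i j → i ≠ u → j ≠ u → (c i ↔ c j) :=
    fun i j h1 h2 h3 => h i j h2 h3 h1
  -- These seventeen edges already form a spanning subgraph that stays connected after deletion of
  -- any vertex.
  have e1 := e 0 1 (by decide)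
  have e2 := e 0 3 (by decide)
  have e3 := e 0 6 (by decide)
  have e4 := e 0 11 (by decide)
  have e5 := e 1 2 (by decide)
  have e6 := e 1 5 (by decide)
  have e7 := e 1 8 (by decide)
  have e8 := e 2 3 (by decide)
  have e9 := e 2 7 (by decide)
  have e10 := e 2 10 (by decide)
  have e11 := e 3 4 (by decide)
  have e12 := e 3 9 (by decide)
  have e13 := e 6 5 (by decide)
  have e14 := e 11 10 (by decide)
  have e15 := e 7 8 (by decide)
  have e16 := e 4 11 (by decide)
  have e17 := e 9 10 (by decide)
  clear e h
  simp only [Fin.forall_fin_succ]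
  by_cases h0 : c 0 <;> by_cases h1 : c 1 <;> fin_cases u <;> simp at * <;> grind

/-- The Chvátal graph is a subgraph of no word-representable graph in which all its four-cycles
miss a diagonal. -/
theorem not_wordRepresentable_of_chvatal {V : Type*} {G : SimpleGraph V} (f : Fin 12 → V)
    (hf : Function.Injective f) (hG : ∀ i j, chvatal.Adj i j → G.Adj (f i) (f j))
    (hn : ∀ a b c d, chvatal.Adj a b → chvatal.Adj b c → chvatal.Adj c d → chvatal.Adj d a →
      ¬ (G.Adj (f a) (f c) ∧ G.Adj (f b) (f d))) : ¬ WordRepresentable G := by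
  rintro ⟨w, hw⟩
  have h4 : ∀ a b c d, a ≠ c → b ≠ d → chvatal.Adj a b → chvatal.Adj b c → chvatal.Adj c d →
      chvatal.Adj d a → sign w f a b + sign w f b c + sign w f c d + sign w f d a = 0 :=
    fun a b c d hac hbd hab hbc hcd hda =>
      sign_fourCycle hw (hf.ne hac) (hf.ne hbd) (hG _ _ hab) (hG _ _ hbc) (hG _ _ hcd)
        (hG _ _ hda) (hn a b c d hab hbc hcd hda)
  have hs : ∀ i j, i ≠ j → sign w f j i = - sign w f i j := fun i j h => sign_swap w f h
  have hp : ∀ i j, sign w f i j = 1 ∨ sign w f i j = -1 := fun i j => by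
    unfold sign; split_ifs <;> simp
  -- The eleven four-cycles cover 22 edges, each exactly twice. In `c0 + c1 + c2 - c3 + c4 - c5 - c6
  -- + c7 - c8 + c9 - c10` all edges cancel except those of the five-cycle `0 1 2 7 6`, which are
  -- counted twice in its direction. Its five signs, each `1` or `-1`, cannot add to zero.
  have c0 := h4 0 1 2 3 (by decide) (by decide) (by decide) (by decide) (by decide)
    (by decide)
  have c1 := h4 0 1 5 6 (by decide) (by decide) (by decide) (by decide) (by decide)
    (by decide)
  have c2 := h4 0 3 4 11 (by decide) (by decide) (by decide) (by decide) (by decide)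
    (by decide)
  have c3 := h4 0 6 7 11 (by decide) (by decide) (by decide) (by decide) (by decide)
    (by decide)
  have c4 := h4 1 2 7 8 (by decide) (by decide) (by decide) (by decide) (by decide)
    (by decide)
  have c5 := h4 1 5 4 8 (by decide) (by decide) (by decide) (by decide) (by decide)
    (by decide)
  have c6 := h4 2 3 9 10 (by decide) (by decide) (by decide) (by decide) (by decide)
    (by decide)
  have c7 := h4 2 7 6 10 (by decide) (by decide) (by decide) (by decide) (by decide)
    (by decide)
  have c8 := h4 3 4 5 9 (by decide) (by decide) (by decide) (by decide) (by decide)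
    (by decide)
  have c9 := h4 4 8 7 11 (by decide) (by decide) (by decide) (by decide) (by decide)
    (by decide)
  have c10 := h4 5 6 10 9 (by decide) (by decide) (by decide) (by decide) (by decide)
    (by decide)
  have s0_3 := hs 0 3 (by decide)
  have s0_6 := hs 0 6 (by decide)
  have s0_11 := hs 0 11 (by decide)
  have s1_8 := hs 1 8 (by decide)
  have s2_10 := hs 2 10 (by decide)
  have s3_9 := hs 3 9 (by decide)
  have s4_5 := hs 4 5 (by decide)
  have s4_11 := hs 4 11 (by decide)
  have s5_9 := hs 5 9 (by decide)
  have s6_7 := hs 6 7 (by decide)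
  have s7_8 := hs 7 8 (by decide)
  have s9_10 := hs 9 10 (by decide)
  have p0_1 := hp 0 1
  have p1_2 := hp 1 2
  have p2_7 := hp 2 7
  have p6_7 := hp 6 7
  have p0_6 := hp 0 6
  omega

/-! ### Comparability graphs and circle graphs -/

theorem IsComparabilityGraph.comap {V W : Type*} {G : SimpleGraph V} {H : SimpleGraph W}
    (f : G ↪g H) (h : IsComparabilityGraph H) : IsComparabilityGraph G := by
  obtain ⟨r, ⟨h1, h2⟩, h3⟩ := h
  exact ⟨fun u v => r (f u) (f v), ⟨fun u v => by rw [← f.map_adj_iff, h1],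
    fun u v => h2 _ _⟩, fun u v z => h3 _ _ _⟩

theorem IsCircleGraph.comap {V W : Type*} {G : SimpleGraph V} {H : SimpleGraph W}
    (f : G ↪g H) (h : IsCircleGraph H) : IsCircleGraph G := by
  obtain ⟨p, q, h1, h2⟩ := h
  exact ⟨p ∘ f, q ∘ f, fun v => h1 _, fun u v huv => by
    rw [← f.map_adj_iff]; exact h2 _ _ (f.injective.ne huv)⟩

/-- A triangle-free comparability graph contains no five-cycle. -/
theorem IsComparabilityGraph.false_of_fiveCycle {V : Type*} {G : SimpleGraph V}
    (h : IsComparabilityGraph G) (ht : ∀ a b c, G.Adj a b → G.Adj b c → ¬ G.Adj a c)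
    {a b c d e : V} (hab : G.Adj a b) (hbc : G.Adj b c) (hcd : G.Adj c d) (hde : G.Adj d e)
    (hea : G.Adj e a) : False := by
  obtain ⟨r, ⟨h1, h2⟩, h3⟩ := h
  -- Without triangles, two consecutive directed edges are impossible, since transitivity would
  -- close them. So every vertex is a source or a sink (`out`, `inn`), and the two kinds would
  -- alternate around an odd cycle.
  have out : ∀ {x y z}, r x y → G.Adj y z → r z y := fun {x y z} hxy hyz => by
    refine ((h1 y z).1 hyz).resolve_left fun hr => ?_
    exact ht x y z ((h1 _ _).2 (Or.inl hxy)) hyz ((h1 _ _).2 (Or.inl (h3 _ _ _ hxy hr)))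
  have inn : ∀ {x y z}, r y x → G.Adj y z → r y z := fun {x y z} hyx hyz => by
    refine ((h1 y z).1 hyz).resolve_right fun hr => ?_
    exact ht z y x hyz.symm ((h1 _ _).2 (Or.inl hyx)) ((h1 _ _).2 (Or.inl (h3 _ _ _ hr hyx)))
  rcases (h1 a b).1 hab with hr | hr
  · exact h2 _ _ (inn (out (inn (out hr hbc) hcd) hde) hea) (inn hr hea.symm)
  · exact h2 _ _ (inn (out (inn (out (inn hr hbc) hcd) hde) hea) hab) hr

/-- The affine function of `z` that vanishes on the line through `p` and `q`. -/
def lineForm (p q z : ℂ) : ℝ :=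
  (z.im - p.im) * (q.re - p.re) - (z.re - p.re) * (q.im - p.im)

theorem lineForm_combo (p q x y : ℂ) {a b : ℝ} (h : a + b = 1) :
    lineForm p q (a • x + b • y) = a * lineForm p q x + b * lineForm p q y := by
  obtain rfl : b = 1 - a := by linarith
  simp only [lineForm, Complex.add_re, Complex.add_im, Complex.real_smul, Complex.mul_re,
    Complex.mul_im, Complex.ofReal_re, Complex.ofReal_im]
  ring

theorem lineForm_eq_zero_of_mem {p q z : ℂ} (h : z ∈ segment ℝ p q) : lineForm p q z = 0 := by
  obtain ⟨a, b, -, -, hab, rfl⟩ := h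
  rw [lineForm_combo p q p q hab]
  simp [lineForm]
  right; ring

theorem continuous_lineForm (p q : ℂ) : Continuous (lineForm p q) := by
  unfold lineForm
  fun_prop

/-- The line through two points of the unit circle meets the unit disc in a chord. -/
theorem mem_segment_of_lineForm_eq_zero {p q z : ℂ} (hp : ‖p‖ = 1) (hq : ‖q‖ = 1) (hpq : p ≠ q)
    (hz : ‖z‖ ≤ 1) (h : lineForm p q z = 0) : z ∈ segment ℝ p q := by
  have sq : ∀ x : ℂ, ‖x‖ ^ 2 = x.re ^ 2 + x.im ^ 2 := fun x => by
    rw [← Complex.normSq_eq_norm_sq, Complex.normSq_apply]; ring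
  have hp' := sq p
  have hq' := sq q
  have hz' : z.re ^ 2 + z.im ^ 2 ≤ 1 := by
    rw [← sq z]; exact pow_le_one₀ (norm_nonneg _) hz
  rw [hp, one_pow] at hp'
  rw [hq, one_pow] at hq'
  unfold lineForm at h
  set D : ℝ := (q.re - p.re) ^ 2 + (q.im - p.im) ^ 2 with hD
  have hDpos : 0 < D := by
    by_contra hn
    have h1 : q.re - p.re = 0 := by
      nlinarith [sq_nonneg (q.re - p.re), sq_nonneg (q.im - p.im)]
    have h2 : q.im - p.im = 0 := by
      nlinarith [sq_nonneg (q.re - p.re), sq_nonneg (q.im - p.im)]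
    exact hpq (Complex.ext (by linarith) (by linarith))
  -- The parameter on the line of the orthogonal projection of `z`, which is `z` itself by `h`.
  set t : ℝ := ((z.re - p.re) * (q.re - p.re) + (z.im - p.im) * (q.im - p.im)) / D with ht
  have htD : t * D = (z.re - p.re) * (q.re - p.re) + (z.im - p.im) * (q.im - p.im) :=
    div_mul_cancel₀ _ hDpos.ne'
  have hre : z.re = p.re + t * (q.re - p.re) := by
    apply mul_right_cancel₀ hDpos.ne'
    linear_combination (-(q.im - p.im)) * h - (q.re - p.re) * htD + (z.re - p.re) * hD
  have him : z.im = p.im + t * (q.im - p.im) := by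
    apply mul_right_cancel₀ hDpos.ne'
    linear_combination (q.re - p.re) * h - (q.im - p.im) * htD + (z.im - p.im) * hD
  -- The power of the point `z` with respect to the unit circle, up to sign: it is nonnegative in
  -- the disc, which puts `t` between 0 and 1.
  have ht2 : t * (1 - t) * D = 1 - (z.re ^ 2 + z.im ^ 2) := by
    rw [hre, him, hD]
    linear_combination (t - 1) * hp' - t * hq'
  have ht3 : 0 ≤ t * (1 - t) := by
    by_contra hn
    nlinarith
  refine ⟨1 - t, t, by nlinarith, by nlinarith, by ring, ?_⟩
  apply Complex.ext
  · simp [hre]; ring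
  · simp [him]; ring

theorem norm_le_one_of_mem_segment {p q z : ℂ} (hp : ‖p‖ = 1) (hq : ‖q‖ = 1)
    (hz : z ∈ segment ℝ p q) : ‖z‖ ≤ 1 := by
  have := (convex_closedBall (0 : ℂ) 1).segment_subset (x := p) (y := q) (by simp [hp])
    (by simp [hq]) hz
  simpa using this

/-- A chord disjoint from the chord `pq` lies on one side of it. -/
theorem lineForm_pos_or_neg {p q x y : ℂ} (hp : ‖p‖ = 1) (hq : ‖q‖ = 1) (hpq : p ≠ q)
    (hx : ‖x‖ = 1) (hy : ‖y‖ = 1)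
    (h : ¬ (segment ℝ p q ∩ segment ℝ x y).Nonempty) :
    (∀ z ∈ segment ℝ x y, 0 < lineForm p q z) ∨ ∀ z ∈ segment ℝ x y, lineForm p q z < 0 := by
  by_contra! hn
  obtain ⟨⟨a, ha, ha'⟩, b, hb, hb'⟩ := hn
  obtain ⟨z, hz, hz'⟩ := (convex_segment x y).isPreconnected.intermediate_value ha hb
    (continuous_lineForm p q).continuousOn ⟨ha', hb'⟩
  exact h ⟨z, mem_segment_of_lineForm_eq_zero hp hq hpq
    (norm_le_one_of_mem_segment hx hy hz) hz', hz⟩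

/-- Of three points on a segment one lies between the other two. -/
theorem mem_segment_of_three {p q a b c : ℂ} (ha : a ∈ segment ℝ p q) (hb : b ∈ segment ℝ p q)
    (hc : c ∈ segment ℝ p q) :
    b ∈ segment ℝ a c ∨ c ∈ segment ℝ b a ∨ a ∈ segment ℝ c b := by
  simp only [mem_segment_iff_wbtw]
  apply Collinear.wbtw_or_wbtw_or_wbtw
  rw [collinear_iff_exists_forall_eq_smul_vadd]
  rw [segment_eq_image_lineMap] at ha hb hc
  obtain ⟨r, -, rfl⟩ := ha
  obtain ⟨s, -, rfl⟩ := hb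
  obtain ⟨t, -, rfl⟩ := hc
  refine ⟨p, q - p, ?_⟩
  simp only [Set.mem_insert_iff, Set.mem_singleton_iff]
  rintro _ (rfl | rfl | rfl)
  · exact ⟨r, rfl⟩
  · exact ⟨s, rfl⟩
  · exact ⟨t, rfl⟩

/-- The cube without a vertex is not an induced subgraph of a circle graph. Here `c` is the vertex
opposite to the missing one, and edges between the `yᵢ` are allowed. -/
theorem IsCircleGraph.false_of_cube_minus_vertex {V : Type*} {G : SimpleGraph V}
    (h : IsCircleGraph G) {c x₁ x₂ x₃ y₁ y₂ y₃ : V}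
    (hx₁ : G.Adj c x₁) (hx₂ : G.Adj c x₂) (hx₃ : G.Adj c x₃)
    (d₁₂ : x₁ ≠ x₂) (d₁₃ : x₁ ≠ x₃) (d₂₃ : x₂ ≠ x₃)
    (n₁₂ : ¬ G.Adj x₁ x₂) (n₁₃ : ¬ G.Adj x₁ x₃) (n₂₃ : ¬ G.Adj x₂ x₃)
    (e₁ : x₁ ≠ y₁) (e₂ : x₂ ≠ y₂) (e₃ : x₃ ≠ y₃)
    (m₁ : ¬ G.Adj x₁ y₁) (m₂ : ¬ G.Adj x₂ y₂) (m₃ : ¬ G.Adj x₃ y₃)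
    (a₁₂ : G.Adj y₁ x₂) (a₁₃ : G.Adj y₁ x₃) (a₂₁ : G.Adj y₂ x₁) (a₂₃ : G.Adj y₂ x₃)
    (a₃₁ : G.Adj y₃ x₁) (a₃₂ : G.Adj y₃ x₂) : False := by
  obtain ⟨p, q, hpq, hG⟩ := h
  have meet : ∀ {u v}, G.Adj u v →
      (segment ℝ (p u) (q u) ∩ segment ℝ (p v) (q v)).Nonempty := fun h => (hG _ _ h.ne).1 h
  have side : ∀ {u v}, u ≠ v → ¬ G.Adj u v →
      (∀ z ∈ segment ℝ (p v) (q v), 0 < lineForm (p u) (q u) z) ∨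
        ∀ z ∈ segment ℝ (p v) (q v), lineForm (p u) (q u) z < 0 := fun {u v} huv h =>
    lineForm_pos_or_neg (hpq u).1 (hpq u).2.1 (hpq u).2.2 (hpq v).1 (hpq v).2.1
      fun hne => h ((hG _ _ huv).2 hne)
  -- If `m` crosses a common chord between `x` and `z`, its line separates `x` from `z`. But `y`
  -- misses `m` and meets both, which puts `x`, `y` and `z` strictly on one side of that line.
  -- Below, `m` is the middle one of the three chords crossing `c`.
  have key : ∀ {x m z y : V} {t s r : ℂ}, t ∈ segment ℝ (p x) (q x) → s ∈ segment ℝ (p m) (q m) →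
      r ∈ segment ℝ (p z) (q z) → s ∈ segment ℝ t r → m ≠ x → m ≠ z → m ≠ y →
      ¬ G.Adj m x → ¬ G.Adj m z → ¬ G.Adj m y → G.Adj y x → G.Adj y z → False := by
    intro x m z y t s r ht hs hr hsr hmx hmz hmy gmx gmz gmy gyx gyz
    obtain ⟨k, hky, hkx⟩ := meet gyx
    obtain ⟨l, hly, hlz⟩ := meet gyz
    have h0 := lineForm_eq_zero_of_mem hs
    obtain ⟨a, b, ha, hb, hab, rfl⟩ := hsr
    rw [lineForm_combo _ _ _ _ hab] at h0
    have hab' : 0 < a ∨ 0 < b := by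
      by_contra! hn
      linarith
    rcases side hmx gmx with h1 | h1 <;> rcases side hmz gmz with h2 | h2 <;>
      rcases side hmy gmy with h3 | h3 <;>
      have k1 := h1 k hkx <;> have k2 := h3 k hky <;> have k3 := h2 l hlz <;>
      have k4 := h3 l hly <;> have k5 := h1 t ht <;> have k6 := h2 r hr <;>
      first
      | exact absurd k1 (not_lt_of_gt k2)
      | exact absurd k3 (not_lt_of_gt k4)
      | rcases hab' with h | h <;> nlinarith
  obtain ⟨t₁, c₁, h₁⟩ := meet hx₁
  obtain ⟨t₂, c₂, h₂⟩ := meet hx₂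
  obtain ⟨t₃, c₃, h₃⟩ := meet hx₃
  have n₂₁ := fun h => n₁₂ (G.adj_symm h)
  have n₃₁ := fun h => n₁₃ (G.adj_symm h)
  have n₃₂ := fun h => n₂₃ (G.adj_symm h)
  rcases mem_segment_of_three c₁ c₂ c₃ with h | h | h
  · exact key h₁ h₂ h₃ h d₁₂.symm d₂₃ e₂ n₂₁ n₂₃ m₂ a₂₁ a₂₃
  · exact key h₂ h₃ h₁ h d₂₃.symm d₁₃.symm e₃ n₃₂ n₃₁ m₃ a₃₂ a₃₁
  · exact key h₃ h₁ h₂ h d₁₃ d₁₂ e₁ n₁₃ n₁₂ m₁ a₁₃ a₁₂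

/-! ### The Chvátal graph and the tools -/

/-- If deleting edges of a word-representable graph `G` gives a graph `H` with an induced Chvátal
graph, then both diagonals of some four-cycle of `H` were deleted. -/
theorem exists_fourCycle_of_embedding {V : Type*} {G H : SimpleGraph V} (hG : WordRepresentable G)
    (hle : H ≤ G) (f : chvatal ↪g H) : ∃ a b c d, H.Adj a b ∧ H.Adj b c ∧ H.Adj c d ∧ H.Adj d a ∧
      (G.Adj a c ∧ ¬ H.Adj a c) ∧ (G.Adj b d ∧ ¬ H.Adj b d) := by
  by_contra hn
  refine not_wordRepresentable_of_chvatal f f.injective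
    (fun i j h => hle (f.map_adj_iff.2 h)) (fun a b c d hab hbc hcd hda h => hn ?_) hG
  refine ⟨f a, f b, f c, f d, ?_⟩
  simp only [f.map_adj_iff]
  exact ⟨hab, hbc, hcd, hda, ⟨h.1, chvatal_triangleFree a b c hab hbc⟩,
    h.2, chvatal_triangleFree b c d hbc hcd⟩

theorem isEmpty_embedding_of_wordRepresentable {V : Type*} {G : SimpleGraph V}
    (hG : WordRepresentable G) : IsEmpty (chvatal ↪g G) := by
  refine ⟨fun f => ?_⟩
  obtain ⟨a, b, c, d, -, -, -, -, h, -⟩ := exists_fourCycle_of_embedding hG le_rfl f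
  exact h.2 h.1

/-- If both diagonals of a four-cycle are deleted, all its vertices lie in `A`, so its sides are
deleted as well. -/
theorem isEmpty_embedding_removeInside {V : Type*} {G : SimpleGraph V}
    (hG : WordRepresentable G) (A : Set V) : IsEmpty (chvatal ↪g removeInside G A) := by
  refine ⟨fun f => ?_⟩
  obtain ⟨a, b, c, d, hab, -, -, -, hac, hbd⟩ :=
    exists_fourCycle_of_embedding hG (deleteEdges_le _) f
  have mem : ∀ {x y}, G.Adj x y ∧ ¬ (removeInside G A).Adj x y → x ∈ A := by
    rintro x y ⟨h1, h2⟩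
    simp only [removeInside, deleteEdges_adj, Set.mem_ofPred_eq, not_and, not_not] at h2
    obtain ⟨u, hu, v, hv, h⟩ := h2 h1
    rcases Sym2.eq_iff.1 h with ⟨rfl, rfl⟩ | ⟨rfl, rfl⟩ <;> assumption
  exact (deleteEdges_adj.1 hab).2 ⟨a, mem hac, b, mem hbd, rfl⟩

/-- All deleted edges share the vertex `v`, but the two diagonals of a four-cycle have no common
vertex. -/
theorem isEmpty_embedding_removeStar {V : Type*} {G : SimpleGraph V}
    (hG : WordRepresentable G) (A : Set V) (v : V) : IsEmpty (chvatal ↪g removeStar G A v) := by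
  refine ⟨fun f => ?_⟩
  obtain ⟨a, b, c, d, hab, hbc, hcd, hda, hac, hbd⟩ :=
    exists_fourCycle_of_embedding hG (deleteEdges_le _) f
  have mem : ∀ {x y}, G.Adj x y ∧ ¬ (removeStar G A v).Adj x y → x = v ∨ y = v := by
    rintro x y ⟨h1, h2⟩
    simp only [removeStar, deleteEdges_adj, Set.mem_ofPred_eq, not_and, not_not] at h2
    obtain ⟨u, hu, h⟩ := h2 h1
    rcases Sym2.eq_iff.1 h with ⟨rfl, rfl⟩ | ⟨rfl, rfl⟩ <;> simp
  rcases mem hac with rfl | rfl <;> rcases mem hbd with h | h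
  · exact hab.ne h.symm
  · exact hda.ne h
  · exact hbc.ne h
  · exact hcd.ne h.symm

/-- The Chvátal graph is two-connected: if the vertices on which `P` holds are at most one, any
two others are joined by a path avoiding it. -/
theorem chvatal_monochromatic (P c : Fin 12 → Prop) (hP : ∀ i j, P i → P j → i = j)
    (h : ∀ i j, ¬ P i → ¬ P j → chvatal.Adj i j → (c i ↔ c j)) :
    (∀ i, ¬ P i → c i) ∨ ∀ i, ¬ P i → ¬ c i := by
  by_cases hu : ∃ u, P u
  · obtain ⟨u, hu⟩ := hu
    have hne : ∀ i, i ≠ u ↔ ¬ P i := fun i => by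
      refine not_congr ⟨fun h => h ▸ hu, fun h => hP _ _ h hu⟩
    simp only [← hne] at h ⊢
    exact chvatal_monochromatic_of_ne u c h
  · push Not at hu
    have h01 := h 0 1 (hu 0) (hu 1) (by decide)
    rcases chvatal_monochromatic_of_ne 0 c fun i j _ _ => h i j (hu i) (hu j) with h' | h'
    · refine Or.inl fun i _ => ?_
      by_cases hi : i = 0
      · exact hi ▸ h01.2 (h' 1 (by decide))
      · exact h' i hi
    · refine Or.inr fun i _ => ?_
      by_cases hi : i = 0
      · exact hi ▸ fun h0 => h' 1 (by decide) (h01.1 h0)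
      · exact h' i hi

/-- A map through which an induced embedding factors is an induced embedding. -/
theorem nonempty_embedding_of_factor {U V W : Type*} {F : SimpleGraph U} {G : SimpleGraph V}
    {H : SimpleGraph W} (f : F ↪g H) (ρ : U → V → Prop) (hρ : ∀ i, ∃ x, ρ i x)
    (hf : ∀ {i j x}, ρ i x → ρ j x → f i = f j)
    (hadj : ∀ {i j x y}, ρ i x → ρ j y → (H.Adj (f i) (f j) ↔ G.Adj x y)) :
    Nonempty (F ↪g G) := by
  choose g hg using hρ
  refine ⟨⟨⟨g, fun i j hij => f.injective (hf (hg i) (hij ▸ hg j))⟩, ?_⟩⟩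
  intro i j
  rw [← f.map_adj_iff]
  exact (hadj (hg i) (hg j)).symm

theorem nonempty_embedding_of_sum {V₁ V₂ : Type*} {G₁ : SimpleGraph V₁} {G₂ : SimpleGraph V₂}
    (f : chvatal ↪g (G₁ ⊕g G₂)) : Nonempty (chvatal ↪g G₁) ∨ Nonempty (chvatal ↪g G₂) := by
  rcases chvatal_monochromatic (fun _ => False) (fun i => (f i).isLeft) (by simp)
    (fun i j _ _ hij => by
      rw [← f.map_adj_iff] at hij
      cases hi : f i <;> cases hj : f j <;> simp_all) with h | h
  · refine Or.inl (nonempty_embedding_of_factor f (fun i x => f i = Sum.inl x) (fun i => ?_)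
      (fun h1 h2 => h1.trans h2.symm) (fun h1 h2 => by simp [h1, h2]))
    simpa [Sum.isLeft_iff] using h i
  · refine Or.inr (nonempty_embedding_of_factor f (fun i x => f i = Sum.inr x) (fun i => ?_)
      (fun h1 h2 => h1.trans h2.symm) (fun h1 h2 => by simp [h1, h2]))
    simpa [Sum.isRight_iff] using h i

theorem nonempty_embedding_of_connectByEdge {V₁ V₂ : Type*} {G₁ : SimpleGraph V₁}
    {G₂ : SimpleGraph V₂} {a : V₁} {b : V₂} (f : chvatal ↪g connectByEdge G₁ G₂ a b) :
    Nonempty (chvatal ↪g G₁) ∨ Nonempty (chvatal ↪g G₂) := by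
  have hLL : ∀ x y, (connectByEdge G₁ G₂ a b).Adj (Sum.inl x) (Sum.inl y) ↔ G₁.Adj x y := by
    simp [connectByEdge, edge_adj]
  have hRR : ∀ x y, (connectByEdge G₁ G₂ a b).Adj (Sum.inr x) (Sum.inr y) ↔ G₂.Adj x y := by
    simp [connectByEdge, edge_adj]
  have hLR : ∀ x y, (connectByEdge G₁ G₂ a b).Adj (Sum.inl x) (Sum.inr y) ↔ x = a ∧ y = b := by
    simp [connectByEdge, edge_adj]
  have hRL : ∀ x y, (connectByEdge G₁ G₂ a b).Adj (Sum.inr x) (Sum.inl y) ↔ y = a ∧ x = b := by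
    intro x y; rw [adj_comm, hLR]
  -- Every edge between the two sides uses `inl a`, so the rest of the copy lies on one side.
  rcases chvatal_monochromatic (fun i => f i = Sum.inl a) (fun i => (f i).isLeft)
    (fun i j hi hj => f.injective (hi.trans hj.symm))
    (fun i j hi hj hij => by
      rw [← f.map_adj_iff] at hij
      cases hi' : f i <;> cases hj' : f j <;> simp_all) with h | h
  · refine Or.inl (nonempty_embedding_of_factor f (fun i x => f i = Sum.inl x) (fun i => ?_)
      (fun h1 h2 => h1.trans h2.symm) (fun h1 h2 => by rw [h1, h2, hLL]))
    by_cases hi : f i = Sum.inl a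
    · exact ⟨a, hi⟩
    · simpa [Sum.isLeft_iff] using h i hi
  · refine Or.inr (nonempty_embedding_of_factor f (fun i x => f i = Sum.inr x) (fun i => ?_)
      (fun h1 h2 => h1.trans h2.symm) (fun h1 h2 => by rw [h1, h2, hRR]))
    -- With the rest on the right, a copy using `inl a` would give this vertex the single possible
    -- neighbour `inr b`, against degree at least three.
    by_cases hi : f i = Sum.inl a
    · obtain ⟨x, y, -, hxy, -, -, hx, hy, -⟩ := chvatal_exists_three_neighbors i
      have key : ∀ {x}, chvatal.Adj i x → f x = Sum.inr b := fun {x} hx => by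
        have hne : f x ≠ Sum.inl a := fun h' => hx.ne (f.injective (hi.trans h'.symm))
        have hx' := f.map_adj_iff.2 hx
        have hr : ∃ y, f x = Sum.inr y := by simpa [Sum.isRight_iff] using h x hne
        obtain ⟨y, hy⟩ := hr
        rw [hi, hy, hLR] at hx'
        rw [hy, hx'.2]
      exact (hxy (f.injective ((key hx).trans (key hy).symm))).elim
    · simpa [Sum.isRight_iff] using h i hi

theorem nonempty_embedding_of_glue {V₁ V₂ : Type*} {G₁ : SimpleGraph V₁}
    {G₂ : SimpleGraph V₂} {a : V₁} {b : V₂} (f : chvatal ↪g glue G₁ G₂ a b) :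
    Nonempty (chvatal ↪g G₁) ∨ Nonempty (chvatal ↪g G₂) := by
  have hLL : ∀ x y, (glue G₁ G₂ a b).Adj (Sum.inl x) (Sum.inl y) ↔ G₁.Adj x y :=
    fun _ _ => Iff.rfl
  have hRR : ∀ x y, (glue G₁ G₂ a b).Adj (Sum.inr x) (Sum.inr y) ↔ G₂.Adj x y :=
    fun _ _ => Iff.rfl
  have hLR : ∀ x y, (glue G₁ G₂ a b).Adj (Sum.inl x) (Sum.inr y) ↔ x = a ∧ G₂.Adj b y :=
    fun _ _ => Iff.rfl
  have hRL : ∀ x y, (glue G₁ G₂ a b).Adj (Sum.inr x) (Sum.inl y) ↔ y = a ∧ G₂.Adj b x :=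
    fun _ _ => Iff.rfl
  rcases chvatal_monochromatic (fun i => f i = Sum.inl a) (fun i => (f i).isLeft)
    (fun i j hi hj => f.injective (hi.trans hj.symm))
    (fun i j hi hj hij => by
      rw [← f.map_adj_iff] at hij
      cases hi' : f i <;> cases hj' : f j <;> simp_all) with h | h
  · refine Or.inl (nonempty_embedding_of_factor f (fun i x => f i = Sum.inl x) (fun i => ?_)
      (fun h1 h2 => h1.trans h2.symm) (fun h1 h2 => by rw [h1, h2, hLL]))
    by_cases hi : f i = Sum.inl a
    · exact ⟨a, hi⟩
    · simpa [Sum.isLeft_iff] using h i hi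
  · refine Or.inr (nonempty_embedding_of_factor f
      -- On the right-hand side the common vertex `inl a` plays the role of `b`.
      (fun i y => (f i = Sum.inl a ∧ y = b) ∨ ∃ z, f i = Sum.inr z ∧ z.val = y)
      (fun i => ?_) ?_ ?_)
    · by_cases hi : f i = Sum.inl a
      · exact ⟨b, Or.inl ⟨hi, rfl⟩⟩
      · have hr : ∃ z, f i = Sum.inr z := by rw [← Sum.isRight_iff]; simpa using h i hi
        obtain ⟨z, hz⟩ := hr
        exact ⟨z, Or.inr ⟨z, hz, rfl⟩⟩
    · rintro i j x (⟨hi, rfl⟩ | ⟨y, hi, rfl⟩) (⟨hj, hx⟩ | ⟨z, hj, hx⟩)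
      · rw [hi, hj]
      · exact (z.2 hx).elim
      · exact (y.2 hx).elim
      · rw [hi, hj, Subtype.ext hx]
    · rintro i j x x' (⟨hi, rfl⟩ | ⟨y, hi, rfl⟩) (⟨hj, rfl⟩ | ⟨z, hj, rfl⟩)
      · simp [hi, hj]
      · simp [hi, hj, hLR]
      · simp [hi, hj, hRL, G₂.adj_comm]
      · rw [hi, hj, hRR]

theorem embedding_addVertex_ne_none {V : Type*} {G : SimpleGraph V} {x y : V}
    (f : chvatal ↪g addVertex G x y) (i : Fin 12) : f i ≠ none := by
  intro hi
  obtain ⟨u, v, w, huv, huw, hvw, hu, hv, hw⟩ := chvatal_exists_three_neighbors i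
  have key : ∀ {j}, chvatal.Adj i j → f j = some x ∨ f j = some y := fun {j} hj => by
    have hj' := f.map_adj_iff.2 hj
    rw [hi] at hj'
    cases hf : f j with
    | none => rw [hf] at hj'; exact hj'.elim
    | some z =>
      rw [hf] at hj'
      rcases (show z = x ∨ z = y from hj') with rfl | rfl <;> simp
  have inj : ∀ {j k z}, f j = some z → f k = some z → j = k :=
    fun h1 h2 => f.injective (h1.trans h2.symm)
  rcases key hu with h1 | h1 <;> rcases key hv with h2 | h2 <;> rcases key hw with h3 | h3 <;>
    first
    | exact huv (inj h1 h2)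
    | exact huw (inj h1 h3)
    | exact hvw (inj h2 h3)

theorem nonempty_embedding_of_addVertex {V : Type*} {G : SimpleGraph V} {x y : V}
    (f : chvatal ↪g addVertex G x y) : Nonempty (chvatal ↪g G) := by
  refine nonempty_embedding_of_factor f (fun i z => f i = some z) (fun i => ?_)
    (fun h1 h2 => h1.trans h2.symm) (fun h1 h2 => by rw [h1, h2]; exact Iff.rfl)
  exact Option.ne_none_iff_exists'.1 (embedding_addVertex_ne_none f i)

theorem not_isComparabilityGraph_deleteVertex_chvatal (v : Fin 12) :
    ¬ IsComparabilityGraph (deleteVertex chvatal v) := by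
  intro h
  have key : ∀ a b c d e : Fin 12, (a ≠ v ∧ b ≠ v ∧ c ≠ v ∧ d ≠ v ∧ e ≠ v) →
      ¬ (chvatal.Adj a b ∧ chvatal.Adj b c ∧ chvatal.Adj c d ∧ chvatal.Adj d e ∧
        chvatal.Adj e a) := by
    rintro a b c d e ⟨ha, hb, hc, hd, he⟩ ⟨hab, hbc, hcd, hde, hea⟩
    exact h.false_of_fiveCycle (a := ⟨a, ha⟩) (b := ⟨b, hb⟩) (c := ⟨c, hc⟩) (d := ⟨d, hd⟩)
      (e := ⟨e, he⟩) (fun x y z hxy hyz => chvatal_triangleFree x y z hxy hyz) hab hbc hcd hde hea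
  -- Two disjoint five-cycles: at least one of them avoids `v`.
  have hv : (0 ≠ v ∧ 1 ≠ v ∧ 2 ≠ v ∧ 7 ≠ v ∧ 6 ≠ v) ∨
      (3 ≠ v ∧ 4 ≠ v ∧ 11 ≠ v ∧ 10 ≠ v ∧ 9 ≠ v) := by
    clear h key
    revert v
    decide
  rcases hv with hv | hv
  · exact key _ _ _ _ _ hv (by decide)
  · exact key _ _ _ _ _ hv (by decide)

theorem not_isCircleGraph_deleteVertex_chvatal (v : Fin 12) :
    ¬ IsCircleGraph (deleteVertex chvatal v) := by
  intro h
  have key : ∀ c x₁ x₂ x₃ y₁ y₂ y₃ : Fin 12,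
      (c ≠ v ∧ x₁ ≠ v ∧ x₂ ≠ v ∧ x₃ ≠ v ∧ y₁ ≠ v ∧ y₂ ≠ v ∧ y₃ ≠ v) →
      ¬ ((chvatal.Adj c x₁ ∧ chvatal.Adj c x₂ ∧ chvatal.Adj c x₃) ∧
        (x₁ ≠ x₂ ∧ x₁ ≠ x₃ ∧ x₂ ≠ x₃) ∧
        (¬ chvatal.Adj x₁ x₂ ∧ ¬ chvatal.Adj x₁ x₃ ∧ ¬ chvatal.Adj x₂ x₃) ∧
        (x₁ ≠ y₁ ∧ x₂ ≠ y₂ ∧ x₃ ≠ y₃) ∧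
        (¬ chvatal.Adj x₁ y₁ ∧ ¬ chvatal.Adj x₂ y₂ ∧ ¬ chvatal.Adj x₃ y₃) ∧
        chvatal.Adj y₁ x₂ ∧ chvatal.Adj y₁ x₃ ∧ chvatal.Adj y₂ x₁ ∧ chvatal.Adj y₂ x₃ ∧
        chvatal.Adj y₃ x₁ ∧ chvatal.Adj y₃ x₂) := by
    rintro c x₁ x₂ x₃ y₁ y₂ y₃ ⟨hc, hx₁, hx₂, hx₃, hy₁, hy₂, hy₃⟩
      ⟨⟨h1, h2, h3⟩, ⟨d1, d2, d3⟩, ⟨n1, n2, n3⟩, ⟨e1, e2, e3⟩, ⟨m1, m2, m3⟩,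
        a1, a2, a3, a4, a5, a6⟩
    have ne : ∀ {i j : Fin 12} (hi : i ≠ v) (hj : j ≠ v), i ≠ j →
        (⟨i, hi⟩ : {u : Fin 12 // u ≠ v}) ≠ ⟨j, hj⟩ := fun _ _ hij h => hij (congrArg Subtype.val h)
    exact h.false_of_cube_minus_vertex (c := ⟨c, hc⟩) (x₁ := ⟨x₁, hx₁⟩) (x₂ := ⟨x₂, hx₂⟩)
      (x₃ := ⟨x₃, hx₃⟩) (y₁ := ⟨y₁, hy₁⟩) (y₂ := ⟨y₂, hy₂⟩) (y₃ := ⟨y₃, hy₃⟩) h1 h2 h3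
      (ne _ _ d1) (ne _ _ d2) (ne _ _ d3) n1 n2 n3 (ne _ _ e1) (ne _ _ e2) (ne _ _ e3)
      m1 m2 m3 a1 a2 a3 a4 a5 a6
  -- Four copies of the forbidden configuration, listed as `c, x₁, x₂, x₃, y₁, y₂, y₃`, with no
  -- vertex common to all: at least one of them avoids `v`.
  have hv : (4 ≠ v ∧ 3 ≠ v ∧ 8 ≠ v ∧ 11 ≠ v ∧ 7 ≠ v ∧ 0 ≠ v ∧ 9 ≠ v) ∨
      (8 ≠ v ∧ 1 ≠ v ∧ 4 ≠ v ∧ 7 ≠ v ∧ 11 ≠ v ∧ 2 ≠ v ∧ 5 ≠ v) ∨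
      (9 ≠ v ∧ 3 ≠ v ∧ 5 ≠ v ∧ 10 ≠ v ∧ 6 ≠ v ∧ 2 ≠ v ∧ 4 ≠ v) ∨
      (5 ≠ v ∧ 1 ≠ v ∧ 6 ≠ v ∧ 9 ≠ v ∧ 10 ≠ v ∧ 8 ≠ v ∧ 0 ≠ v) := by
    clear h key
    revert v
    decide
  rcases hv with hv | hv | hv | hv <;> exact key _ _ _ _ _ _ _ hv (by decide)

/-- If `G` has an induced Chvátal graph, then `G \ v` has an induced Chvátal graph minus a
vertex. -/
theorem exists_embedding_deleteVertex {V : Type*} {G : SimpleGraph V} (f : chvatal ↪g G) (v : V) :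
    ∃ u, Nonempty (deleteVertex chvatal u ↪g deleteVertex G v) := by
  obtain ⟨u, hu⟩ : ∃ u, ∀ i, i ≠ u → f i ≠ v := by
    by_cases h : ∃ u, f u = v
    · obtain ⟨u, rfl⟩ := h
      exact ⟨u, fun i hi => f.injective.ne hi⟩
    -- When `v` lies outside the copy, any vertex of the copy may be dropped.
    · exact ⟨0, fun i _ hi => h ⟨i, hi⟩⟩
  exact ⟨u, ⟨⟨⟨fun i => ⟨f i, hu i i.2⟩, fun i j hij =>
    Subtype.ext (f.injective (congrArg Subtype.val hij))⟩, f.map_adj_iff⟩⟩⟩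

/-- No derivable graph has an induced Chvátal graph. -/
theorem Derivable.isEmpty_embedding {V : Type} {G : SimpleGraph V} (h : Derivable G) :
    IsEmpty (chvatal ↪g G) := by
  induction h with
  | wordRepresentable h => exact isEmpty_embedding_of_wordRepresentable h
  | iso _ e ih => exact ⟨fun f => ih.false (e.some.symm.toEmbedding.comp f)⟩
  | disjointUnion _ _ ih₁ ih₂ =>
    exact ⟨fun f => (nonempty_embedding_of_sum f).elim (fun g => ih₁.false g.some)
      fun g => ih₂.false g.some⟩
  | glue a b _ _ ih₁ ih₂ =>
    exact ⟨fun f => (nonempty_embedding_of_glue f).elim (fun g => ih₁.false g.some)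
      fun g => ih₂.false g.some⟩
  | connectByEdge a b _ _ ih₁ ih₂ =>
    exact ⟨fun f => (nonempty_embedding_of_connectByEdge f).elim (fun g => ih₁.false g.some)
      fun g => ih₂.false g.some⟩
  | addVertex x y _ _ ih => exact ⟨fun f => ih.false (nonempty_embedding_of_addVertex f).some⟩
  | removeInside A h => exact isEmpty_embedding_removeInside h A
  | removeStar A v h => exact isEmpty_embedding_removeStar h A v
  | comparability v h =>
    refine ⟨fun f => ?_⟩
    obtain ⟨u, ⟨g⟩⟩ := exists_embedding_deleteVertex f v
    exact not_isComparabilityGraph_deleteVertex_chvatal u (h.comap g)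
  | circle v h =>
    refine ⟨fun f => ?_⟩
    obtain ⟨u, ⟨g⟩⟩ := exists_embedding_deleteVertex f v
    exact not_isCircleGraph_deleteVertex_chvatal u (h.comap g)

theorem card_le_of_embedding {V : Type*} [Finite V] {G : SimpleGraph V} (f : chvatal ↪g G) :
    12 ≤ Nat.card V := by
  simpa using Nat.card_le_card_of_injective f f.injective

end ElevenRep

open ElevenRep SimpleGraph in
theorem mainTheorem8 :
    -- no combination of the tools yields the Chvátal graph
    ¬ Derivable chvatal ∧
    -- first tool, (a), applied to arbitrary 1-11-representable graphs with fewer vertices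
    (∀ (V₁ V₂ : Type) [Finite V₁] [Finite V₂] (G₁ : SimpleGraph V₁) (G₂ : SimpleGraph V₂),
      ElevenRepresentable 1 G₁ → ElevenRepresentable 1 G₂ →
      Nat.card V₁ < 12 → Nat.card V₂ < 12 →
        IsEmpty ((G₁ ⊕g G₂) ≃g chvatal) ∧
        (∀ (a : V₁) (b : V₂), IsEmpty (glue G₁ G₂ a b ≃g chvatal)) ∧
        (∀ (a : V₁) (b : V₂), IsEmpty (connectByEdge G₁ G₂ a b ≃g chvatal))) ∧
    -- first tool, (b)
    (∀ (V : Type) [Finite V] (G : SimpleGraph V), ElevenRepresentable 1 G →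
      ∀ x y : V, G.Adj x y → IsEmpty (addVertex G x y ≃g chvatal)) ∧
    -- second tool, (a) and (b)
    (∀ (V : Type) [Finite V] (G : SimpleGraph V), WordRepresentable G → ∀ A : Set V,
      IsEmpty (removeInside G A ≃g chvatal) ∧
      ∀ v : V, IsEmpty (removeStar G A v ≃g chvatal)) ∧
    -- third tool, (a) and (b)
    (∀ v : Fin 12, ¬ IsComparabilityGraph (deleteVertex chvatal v) ∧
      ¬ IsCircleGraph (deleteVertex chvatal v)) := by
  refine ⟨fun h => h.isEmpty_embedding.false Embedding.refl, ?_, ?_, ?_, fun v =>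
    ⟨not_isComparabilityGraph_deleteVertex_chvatal v, not_isCircleGraph_deleteVertex_chvatal v⟩⟩
  · intro V₁ V₂ _ _ G₁ G₂ _ _ h₁ h₂
    -- The two parts are arbitrary here, so the invariant is replaced by a count: a graph with fewer
    -- than 12 vertices contains no Chvátal graph.
    have key : ¬ (Nonempty (chvatal ↪g G₁) ∨ Nonempty (chvatal ↪g G₂)) := by
      rintro (f | f)
      · exact absurd (card_le_of_embedding f.some) (not_le.2 h₁)
      · exact absurd (card_le_of_embedding f.some) (not_le.2 h₂)
    exact ⟨⟨fun e => key (nonempty_embedding_of_sum e.symm.toEmbedding)⟩,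
      fun a b => ⟨fun e => key (nonempty_embedding_of_glue e.symm.toEmbedding)⟩,
      fun a b => ⟨fun e => key (nonempty_embedding_of_connectByEdge e.symm.toEmbedding)⟩⟩
  · intro V _ G _ x y _
    exact ⟨fun e => embedding_addVertex_ne_none e.symm.toEmbedding (e none) (by simp)⟩
  · intro V _ G hG A
    exact ⟨⟨fun e => (isEmpty_embedding_removeInside hG A).false e.symm.toEmbedding⟩,
      fun v => ⟨fun e => (isEmpty_embedding_removeStar hG A v).false e.symm.toEmbedding⟩⟩
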